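/- Let $R>0$, $\beta>0$ and $\tilde q=e^{-2\pi/\beta}$, and let $\eta(q)=q^{1/24}\prod_{k\ge1}(1-q^k)$. Consider the free boson on the circle of radius $R$, with space of states spanned by the orthogonal Fock modules built on orthonormal oscillator ground states $|p,w\rangle$ with momentum $p=m/R$ and winding number $w$ ($m,w\in\mathbb Z$); the left and right oscillators satisfy $[a_k,a_l]=[\tilde a_k,\tilde a_l]=k\,\delta_{k+l,0}$, $[a_k,\tilde a_l]=0$, $a_k^\dagger=a_{-k}$, $\tilde a_k^\dagger=\tilde a_{-k}$, and $a_k,\tilde a_k$ with $k\ge 1$ annihilate the ground states. Let $$H_\beta=\frac{2\pi}{\beta}\Big[(R\hat w)^2+(\hat p/2)^2+\sum_{k\ge1}a_{-k}a_k+\sum_{k\ge1}\tilde a_{-k}\tilde a_k-\tfrac1{12}\Big],$$ and for $n,m\in\mathbb Z$ define the (formal, non-normalizable) Neumann and Dirichlet Ishibashi states $$|\iota^N_{nR}\rangle=e^{-\sum_{k\ge1}a_{-k}\tilde a_{-k}/k}\,|p=0,\,w=n\rangle,\qquad |\iota^D_{m/2R}\rangle=e^{\sum_{k\ge1}a_{-k}\tilde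 a_{-k}/k}\,|p=m/R,\,w=0\rangle .$$ Then for all $n,m\in\mathbb Z$ the following inner products converge (absolutely, as sums over the orthonormal occupation-number basis) and $$\langle\iota^N_{nR}|e^{-H_\beta/2}|\iota^N_{mR}\rangle=\frac{\tilde q^{R^2n^2/2}}{\eta(\tilde q)}\,\delta_{n,m},\qquad \langle\iota^D_{n/2R}|e^{-H_\beta/2}|\iota^D_{m/2R}\rangle=\frac{\tilde q^{n^2/8R^2}}{\eta(\tilde q)}\,\delta_{n,m},$$ $$\langle\iota^N_{nR}|e^{-H_\beta/2}|\iota^D_{m/2R}\rangle=\tilde q^{-1/24}\prod_{k\ge1}\frac1{1+\tilde q^k}\;\delta_{n,0}\delta_{m,0}=\frac{\sum_{k\in\mathbb Z}(-1)^k\tilde q^{k^2}}{\eta(\tilde q)}\;\delta_{n,0}\delta_{m,0}.$$ -/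

import Mathlib

open scoped ComplexConjugate

noncomputable section

namespace TorusModel

/-- Labels of the orthonormal occupation-number basis of
`⨁_{m, w ∈ ℤ} F_{m/2R + wR} ⊗ F_{m/2R - wR}`.  The vector with label `(m, w, left, right)` is the
normalized multiple of `∏ₖ (a₋ₖ)^(left k) ∏ₖ (ã₋ₖ)^(right k) |p = m/R, w⟩`, where `[aₖ, a₋ₖ] = k`. -/
@[ext] structure Label where
  /-- the integer `m`; the momentum is `p = m / R` -/
  mom : ℤ
  /-- the winding number, i.e. the eigenvalue of `ŵ` -/
  wind : ℤ
  /-- occupation numbers of the left-moving modes `k = 1, 2, …` -/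
  left : ℕ+ →₀ ℕ
  /-- occupation numbers of the right-moving modes `k = 1, 2, …` -/
  right : ℕ+ →₀ ℕ

/-- Formal (not necessarily normalizable) states: arbitrary families of coordinates in the
occupation-number basis, with the topology of coordinatewise convergence.  The Hilbert space of the
model is the subspace of the square-summable families. -/
abbrev FormalState := Label → ℂ

open Classical in
/-- The oscillator ground state `|p = m/R, w⟩`. -/
def ket (m w : ℤ) : FormalState := Pi.single ⟨m, w, 0, 0⟩ 1

/-- The left-moving creation operator `a₋ₖ`.  For `left k = 0` the square root vanishes. -/
def leftCreate (k : ℕ+) (ψ : FormalState) : FormalState := fun s =>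
  (√((k : ℝ) * s.left k) : ℂ) * ψ { s with left := s.left - Finsupp.single k 1 }

/-- The left-moving annihilation operator `aₖ`. -/
def leftAnnihilate (k : ℕ+) (ψ : FormalState) : FormalState := fun s =>
  (√((k : ℝ) * (s.left k + 1)) : ℂ) * ψ { s with left := s.left + Finsupp.single k 1 }

/-- The right-moving creation operator `ã₋ₖ`. -/
def rightCreate (k : ℕ+) (ψ : FormalState) : FormalState := fun s =>
  (√((k : ℝ) * s.right k) : ℂ) * ψ { s with right := s.right - Finsupp.single k 1 }

/-- The right-moving annihilation operator `ãₖ`. -/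
def rightAnnihilate (k : ℕ+) (ψ : FormalState) : FormalState := fun s =>
  (√((k : ℝ) * (s.right k + 1)) : ℂ) * ψ { s with right := s.right + Finsupp.single k 1 }

/-- The operator `p̂ / 2`. -/
def halfMomentum (R : ℝ) (ψ : FormalState) : FormalState := fun s =>
  ((s.mom / (2 * R) : ℝ) : ℂ) * ψ s

/-- The operator `R ŵ`. -/
def radiusWinding (R : ℝ) (ψ : FormalState) : FormalState := fun s =>
  ((R * s.wind : ℝ) : ℂ) * ψ s

/-- The closed string Hamiltonian
`H_β = (2π/β) [(R ŵ)² + (p̂/2)² + ∑ₖ a₋ₖ aₖ + ∑ₖ ã₋ₖ ãₖ - 1/12]`.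
Each coordinate of the two sums has finitely many nonzero terms. -/
def hamiltonian (R β : ℝ) (ψ : FormalState) : FormalState :=
  ((2 * Real.pi / β : ℝ) : ℂ) •
    (radiusWinding R (radiusWinding R ψ) + halfMomentum R (halfMomentum R ψ)
      + (∑' k : ℕ+, leftCreate k (leftAnnihilate k ψ))
      + (∑' k : ℕ+, rightCreate k (rightAnnihilate k ψ))
      - (1 / 12 : ℂ) • ψ)

/-- The exponential `e^A ψ = ∑ⱼ Aʲ ψ / j!` of an operator, as a coordinatewise convergent series. -/
def expOp (A : FormalState → FormalState) (ψ : FormalState) : FormalState :=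
  ∑' j : ℕ, ((Nat.factorial j : ℂ)⁻¹) • (A^[j]) ψ

/-- The operator `∑ₖ a₋ₖ ã₋ₖ / k`.  Each coordinate of the sum has finitely many nonzero terms. -/
def pairCreate (ψ : FormalState) : FormalState :=
  ∑' k : ℕ+, ((k : ℂ)⁻¹) • leftCreate k (rightCreate k ψ)

/-- The Neumann Ishibashi state `exp(-∑ₖ a₋ₖ ã₋ₖ / k) |p = 0, w = n⟩`, of charge `R w = n R`. -/
def neumannState (n : ℤ) : FormalState := expOp (fun ψ => -pairCreate ψ) (ket 0 n)

/-- The Dirichlet Ishibashi state `exp(∑ₖ a₋ₖ ã₋ₖ / k) |p = m/R, w = 0⟩`, of charge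
`p / 2 = m / 2R`. -/
def dirichletState (m : ℤ) : FormalState := expOp pairCreate (ket m 0)

/-- The operator `e^{-H_β / 2}`. -/
def propagator (R β : ℝ) : FormalState → FormalState :=
  expOp (fun ψ => (-(1 / 2) : ℂ) • hamiltonian R β ψ)

/-- `⟨φ| T |ψ⟩` exists (the sum over the orthonormal basis converges absolutely) and equals `z`. -/
def HasMatrixElement (φ : FormalState) (T : FormalState → FormalState) (ψ : FormalState) (z : ℂ) :
    Prop :=
  HasSum (fun s : Label => conj (φ s) * T ψ s) z

/-- The eta function `η(q) = q^(1/24) ∏ₙ (1 - qⁿ)`, as a function of the nome `q = e^{2πiτ}`. -/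
def etaNome (q : ℝ) : ℂ := ModularForm.eta (Complex.log q / (2 * Real.pi * Complex.I))

end TorusModel

end

open scoped ComplexConjugate
open Filter Topology Finset

/-! Since $(a_{-k}\tilde a_{-k}/k)^n/n!$ sends the ground state to the normalized vector with $n$
left and $n$ right quanta, $\exp(\varepsilon\sum_k a_{-k}\tilde a_{-k}/k)|p,w\rangle$ has coordinate
$\varepsilon^{\sum_k l_k}$ where both occupation numbers equal $l$, and zero elsewhere
(`expOp_smul_pairCreate_ket`). The Hamiltonian is diagonal in this basis (`propagator_apply`), and
$e^{-H_\beta/2}$ weights the vector $(l,l)$ by $\tilde q^{\sum_k k l_k}$ times a zero-mode power.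

A matrix element is therefore zero unless the zero modes agree; otherwise it is
$\sum_l\prod_k(\varepsilon\delta\tilde q^k)^{l_k}=\prod_k(1-\varepsilon\delta\tilde q^k)^{-1}$ times
that power (`hasSum_finsupp_prod_pow`, `hasMatrixElement_ishibashi_self`). Equal signs give
$1/\eta$, opposite signs $\prod_k 1/(1+\tilde q^k)$. The theta form of the mixed product is Gauss's
identity, proved by Shanks' telescoping of finite sums. -/

/-! ### Gauss's theta identity by finite sums -/

/-- The partial product `∏_{1 ≤ j ≤ n} (1 - q ^ j) / (1 + q ^ j)`. -/
noncomputable def thetaPartialProd (q : ℝ) (n : ℕ) : ℝ :=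
  ∏ j ∈ range n, (1 - q ^ (j + 1)) / (1 + q ^ (j + 1))

lemma thetaPartialProd_succ (q : ℝ) (n : ℕ) : thetaPartialProd q (n + 1) =
    thetaPartialProd q n * ((1 - q ^ (n + 1)) / (1 + q ^ (n + 1))) :=
  prod_range_succ _ _

lemma thetaPartialProd_pos {q : ℝ} (h0 : 0 < q) (h1 : q < 1) (n : ℕ) :
    0 < thetaPartialProd q n := by
  refine prod_pos fun j _ => div_pos ?_ (by positivity)
  exact sub_pos.2 (pow_lt_one₀ h0.le h1 (by simp))

lemma thetaPartialProd_antitone {q : ℝ} (h0 : 0 < q) (h1 : q < 1) :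
    Antitone (thetaPartialProd q) := by
  refine antitone_nat_of_succ_le fun n => ?_
  rw [thetaPartialProd_succ]
  refine mul_le_of_le_one_right (thetaPartialProd_pos h0 h1 n).le ?_
  have : 0 < q ^ (n + 1) := by positivity
  rw [div_le_one (by positivity)]
  linarith

/-- The `s`-th correction term in Shanks' finite form of Gauss's theta identity. -/
noncomputable def thetaCorrection (q : ℝ) (n s : ℕ) : ℝ :=
  (-1) ^ s * (2 / (1 + q ^ s)) * q ^ (s * (n + 1)) * (thetaPartialProd q n / thetaPartialProd q s)

/-- Each difference in $n$ is also a difference in $s$: the right side is $G(m)-G(0)$, with $G(m)$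
its first summand. This drives the induction on $n$ in the finite identity. -/
lemma thetaCorrection_telescope {q : ℝ} (h0 : 0 < q) (h1 : q < 1) (n m : ℕ) :
    ∑ s ∈ range m, (thetaCorrection q (n + 1) (s + 1) - thetaCorrection q n (s + 1)) =
      (-1) ^ (m + 1) * 2 * q ^ ((m + 1) * (n + 1)) *
        (thetaPartialProd q n / thetaPartialProd q m) / (1 + q ^ (n + 1)) +
      2 * q ^ (n + 1) * thetaPartialProd q n / (1 + q ^ (n + 1)) := by
  induction m with
  | zero => simp [thetaPartialProd]; ring
  | succ m ih =>
    rw [sum_range_succ, ih]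
    have hm := (thetaPartialProd_pos h0 h1 m).ne'
    have ha : 1 - q ^ (m + 1) ≠ 0 := (sub_pos.2 (pow_lt_one₀ h0.le h1 (by simp))).ne'
    have hb : 1 + q ^ (m + 1) ≠ 0 := by positivity
    have hc : 1 + q ^ (n + 1) ≠ 0 := by positivity
    simp only [thetaCorrection, thetaPartialProd_succ]
    have e1 : q ^ ((m + 1) * (n + 1 + 1)) = q ^ ((m + 1) * (n + 1)) * q ^ (m + 1) := by ring
    have e2 : q ^ ((m + 1 + 1) * (n + 1)) = q ^ ((m + 1) * (n + 1)) * q ^ (n + 1) := by ring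
    rw [e1, e2, pow_succ (-1 : ℝ) (m + 1)]
    generalize q ^ ((m + 1) * (n + 1)) = X
    generalize q ^ (m + 1) = Y at *
    generalize q ^ (n + 1) = Z at *
    generalize (-1 : ℝ) ^ (m + 1) = W
    field_simp
    ring

/-- Shanks' finite form of Gauss's theta identity. -/
lemma sum_neg_one_pow_mul_pow_sq {q : ℝ} (h0 : 0 < q) (h1 : q < 1) (n : ℕ) :
    1 + ∑ s ∈ range n, 2 * (-1) ^ (s + 1) * q ^ ((s + 1) ^ 2) =
      thetaPartialProd q n + ∑ s ∈ range n, thetaCorrection q n (s + 1) := by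
  induction n with
  | zero => simp [thetaPartialProd]
  | succ n ih =>
    have ht := thetaCorrection_telescope h0 h1 n n
    rw [sum_sub_distrib, sub_eq_iff_eq_add] at ht
    -- At $m=n$ the ratio of partial products is 1, so the boundary term and the new correction term
    -- add up to $2(-1)^{n+1}q^{(n+1)^2}$; the constant $-G(0)$ cancels the change of the partial
    -- product.
    rw [sum_range_succ, ← add_assoc, ih, sum_range_succ, ht]
    have hn := (thetaPartialProd_pos h0 h1 n).ne'
    have ha : 1 - q ^ (n + 1) ≠ 0 := (sub_pos.2 (pow_lt_one₀ h0.le h1 (by simp))).ne'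
    have hc : 1 + q ^ (n + 1) ≠ 0 := by positivity
    simp only [thetaCorrection, thetaPartialProd_succ]
    have e1 : q ^ ((n + 1) * (n + 1 + 1)) = q ^ ((n + 1) ^ 2) * q ^ (n + 1) := by ring
    have e2 : q ^ ((n + 1) * (n + 1)) = q ^ ((n + 1) ^ 2) := by ring
    rw [e1, e2]
    generalize ∑ s ∈ range n, ((-1) ^ (s + 1) * (2 / (1 + q ^ (s + 1))) * q ^ ((s + 1) * (n + 1)) *
      (thetaPartialProd q n / (thetaPartialProd q s * ((1 - q ^ (s + 1)) / (1 + q ^ (s + 1)))))) = T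
    generalize q ^ ((n + 1) ^ 2) = X
    generalize q ^ (n + 1) = Z at *
    generalize (-1 : ℝ) ^ (n + 1) = W
    field_simp
    ring

lemma abs_thetaCorrection_le {q : ℝ} (h0 : 0 < q) (h1 : q < 1) {n s : ℕ} (hs : s < n) :
    |thetaCorrection q n (s + 1)| ≤ 2 * q ^ n * q ^ s := by
  have hp := thetaPartialProd_pos h0 h1
  rw [thetaCorrection, abs_mul, abs_mul, abs_mul, abs_pow, abs_neg, abs_one, one_pow, one_mul]
  have hA : |2 / (1 + q ^ (s + 1))| ≤ 2 := by
    rw [abs_of_pos (by positivity), div_le_iff₀ (by positivity)]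
    have : 0 < q ^ (s + 1) := by positivity
    linarith
  have hB : |q ^ ((s + 1) * (n + 1))| ≤ q ^ n * q ^ s := by
    rw [abs_of_pos (by positivity), ← pow_add]
    exact pow_le_pow_of_le_one h0.le h1.le (by nlinarith)
  have hC : |thetaPartialProd q n / thetaPartialProd q (s + 1)| ≤ 1 := by
    rw [abs_of_pos (div_pos (hp _) (hp _)), div_le_one (hp _)]
    exact thetaPartialProd_antitone h0 h1 hs
  calc _ ≤ 2 * (q ^ n * q ^ s) * 1 := by gcongr
    _ = _ := by ring

lemma tendsto_sum_thetaCorrection {q : ℝ} (h0 : 0 < q) (h1 : q < 1) :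
    Tendsto (fun n => ∑ s ∈ range n, thetaCorrection q n (s + 1)) atTop (𝓝 0) := by
  refine squeeze_zero_norm (a := fun n => 2 * q ^ n * (1 - q)⁻¹) (fun n => ?_) ?_
  · refine (norm_sum_le _ _).trans
      ((sum_le_sum fun s hs => abs_thetaCorrection_le h0 h1 (mem_range.1 hs)).trans ?_)
    rw [← mul_sum]
    gcongr
    rw [← tsum_geometric_of_lt_one h0.le h1]
    exact (summable_geometric_of_lt_one h0.le h1).sum_le_tsum _ fun _ _ => by positivity
  · simpa using ((tendsto_pow_atTop_nhds_zero_of_lt_one h0.le h1).const_mul 2).mul_const (1 - q)⁻¹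

lemma summable_neg_one_zpow_mul_zpow_sq {q : ℝ} (h0 : 0 < q) (h1 : q < 1) :
    Summable fun k : ℤ => (-1 : ℝ) ^ k * q ^ (k ^ 2) := by
  have h : Summable fun n : ℕ => (-1 : ℝ) ^ n * q ^ (n ^ 2) := by
    refine Summable.of_norm_bounded (summable_geometric_of_lt_one h0.le h1) fun n => ?_
    rw [norm_mul, norm_pow, norm_neg, norm_one, one_pow, one_mul, Real.norm_of_nonneg (by positivity)]
    exact pow_le_pow_of_le_one h0.le h1.le (Nat.le_self_pow two_ne_zero n)
  refine Summable.of_nat_of_neg ?_ ?_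
  · exact_mod_cast h
  · simp only [even_two.neg_pow, zpow_neg, ← inv_zpow, inv_neg, inv_one]
    exact_mod_cast h

/-- Gauss's identity `∑ (-1) ^ k q ^ (k ^ 2) = ∏ (1 - q ^ j) / (1 + q ^ j)`, as a limit. -/
lemma tendsto_thetaPartialProd {q : ℝ} (h0 : 0 < q) (h1 : q < 1) :
    Tendsto (thetaPartialProd q) atTop (𝓝 (∑' k : ℤ, (-1 : ℝ) ^ k * q ^ (k ^ 2))) := by
  have h := (summable_neg_one_zpow_mul_zpow_sq h0 h1).hasSum.nat_add_neg.tendsto_sum_nat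
  rw [← tendsto_add_atTop_iff_nat 1] at h
  -- Pairing $k$ with $-k$ counts $k=0$ twice, hence the subtracted 1.
  have h2 := (h.sub_const 1).sub (tendsto_sum_thetaCorrection h0 h1)
  refine Tendsto.congr (fun n => ?_) (h2.trans_eq ?_)
  · have e := sum_neg_one_pow_mul_pow_sq h0 h1 n
    rw [sum_range_succ', sub_eq_iff_eq_add, ← e, ← sub_eq_zero]
    have : ∀ k : ℕ, (-1 : ℝ) ^ ((k + 1 : ℕ) : ℤ) * q ^ (((k + 1 : ℕ) : ℤ) ^ 2) +
        (-1 : ℝ) ^ (-((k + 1 : ℕ) : ℤ)) * q ^ ((-((k + 1 : ℕ) : ℤ)) ^ 2) =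
        2 * (-1) ^ (k + 1) * q ^ ((k + 1) ^ 2) := fun k => by
      simp only [even_two.neg_pow, zpow_neg, ← inv_zpow, inv_neg, inv_one]
      simp only [zpow_natCast, ← Nat.cast_pow]
      ring
    simp only [this]
    simp
    ring
  · simp

/-! ### Infinite products of geometric series -/

lemma Finsupp.prod_pow_add_single {ι R : Type*} [CommMonoid R] (x : ι → R) (l : ι →₀ ℕ)
    (a : ι) (n : ℕ) :
    (l + Finsupp.single a n).prod (fun k n => x k ^ n) = x a ^ n * l.prod fun k n => x k ^ n := by
  classical
  rw [Finsupp.prod_add_index' (by simp) (fun _ _ _ => pow_add _ _ _),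
    Finsupp.prod_single_index (h := fun k n => x k ^ n) (pow_zero _), mul_comm]

/-- Splitting off the exponent of one variable. -/
noncomputable def finsuppInsertEquiv {ι : Type*} [DecidableEq ι] {a : ι} {S : Finset ι} (ha : a ∉ S) :
    ℕ × {l : ι →₀ ℕ // l.support ⊆ S} ≃ {l : ι →₀ ℕ // l.support ⊆ insert a S} where
  toFun p := ⟨p.2.1 + Finsupp.single a p.1, by
    refine Finsupp.support_add.trans (union_subset (p.2.2.trans (subset_insert _ _)) ?_)
    exact Finsupp.support_single_subset.trans (by simp)⟩
  invFun l := (l.1 a, ⟨l.1.erase a, by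
    rw [Finsupp.support_erase]
    exact (erase_subset_erase a l.2).trans (erase_insert_subset a S)⟩)
  left_inv p := by
    have h : p.2.1 a = 0 := Finsupp.notMem_support_iff.1 fun h => ha (p.2.2 h)
    ext1
    · simp [h]
    · ext1
      simp only [Finsupp.erase_add, Finsupp.erase_single, add_zero]
      exact Finsupp.erase_of_notMem_support (fun h => ha (p.2.2 h))
  right_inv l := by
    ext1
    exact Finsupp.erase_add_single a l.1

/-- Induction on `S`, multiplying by one geometric series at a time. Absolute summability is carried
along because the product of two sums needs it. -/
lemma hasSum_finsupp_prod_pow_subset {ι : Type*} {x : ι → ℝ} (hx : ∀ k, |x k| < 1)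
    (S : Finset ι) :
    HasSum (fun l : {l : ι →₀ ℕ // l.support ⊆ S} => l.1.prod fun k n => x k ^ n)
      (∏ k ∈ S, (1 - x k)⁻¹) := by
  classical
  have key : ∀ y : ι → ℝ, (∀ k, |y k| < 1) →
      Summable (fun l : {l : ι →₀ ℕ // l.support ⊆ S} => ‖l.1.prod fun k n => y k ^ n‖) ∧
      HasSum (fun l : {l : ι →₀ ℕ // l.support ⊆ S} => l.1.prod fun k n => y k ^ n)
      (∏ k ∈ S, (1 - y k)⁻¹) := by
    intro y hy
    induction S using Finset.induction_on with
    | empty =>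
      have : Unique {l : ι →₀ ℕ // l.support ⊆ ∅} :=
        ⟨⟨⟨0, by simp⟩⟩, fun l => Subtype.ext (by simpa using l.2)⟩
      refine ⟨(hasSum_unique _).summable, ?_⟩
      have h0 : (default : {l : ι →₀ ℕ // l.support ⊆ ∅}).1 = 0 := by
        simpa using (default : {l : ι →₀ ℕ // l.support ⊆ ∅}).2
      have h := hasSum_unique fun l : {l : ι →₀ ℕ // l.support ⊆ ∅} => l.1.prod fun k n => y k ^ n
      rwa [h0, Finsupp.prod_zero_index] at h
    | insert a S ha ih =>
      have hg : Summable fun n : ℕ => ‖y a ^ n‖ := by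
        simpa using summable_geometric_of_lt_one (abs_nonneg _) (hy a)
      have e : ∀ p, (finsuppInsertEquiv ha p).1.prod (fun k n => y k ^ n) =
          y a ^ p.1 * p.2.1.prod fun k n => y k ^ n :=
        fun p => Finsupp.prod_pow_add_single y _ _ _
      rw [← (finsuppInsertEquiv ha).summable_iff, ← (finsuppInsertEquiv ha).hasSum_iff,
        prod_insert ha]
      simp only [Function.comp_def, e]
      have hs := summable_mul_of_summable_norm hg ih.1
      exact ⟨hs.norm, (hasSum_geometric_of_abs_lt_one (hy a)).mul ih.2 hs⟩
  exact (key x hx).2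

lemma multipliable_one_sub {ι : Type*} {x : ι → ℝ} (hs : Summable x) :
    Multipliable fun k => 1 - x k := by
  simpa [sub_eq_add_neg] using
    multipliable_one_add_of_summable (f := fun k => -x k) (by simpa using hs.abs)

lemma tprod_one_sub_ne_zero {ι : Type*} {x : ι → ℝ} (hx : ∀ k, |x k| < 1) (hs : Summable x) :
    ∏' k, (1 - x k) ≠ 0 := by
  simpa [sub_eq_add_neg] using tprod_one_add_ne_zero_of_summable (f := fun k => -x k)
    (fun k => by linarith [(abs_lt.1 (hx k)).2]) (by simpa using hs.abs)

lemma hasProd_one_sub_inv {ι : Type*} {x : ι → ℝ} (hx : ∀ k, |x k| < 1) (hs : Summable x) :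
    HasProd (fun k => (1 - x k)⁻¹) (∏' k, (1 - x k))⁻¹ := by
  have := Tendsto.inv₀ (multipliable_one_sub hs).hasProd (tprod_one_sub_ne_zero hx hs)
  simpa [HasProd] using this

/-- Expansion of an infinite product of geometric series. -/
theorem hasSum_finsupp_prod_pow {ι : Type*} {x : ι → ℝ} (hx : ∀ k, |x k| < 1)
    (hs : Summable x) :
    HasSum (fun l : ι →₀ ℕ => l.prod fun k n => x k ^ n) (∏' k, (1 - x k))⁻¹ := by
  classical
  have ind : ∀ y : ι → ℝ, (∀ k, |y k| < 1) → ∀ S : Finset ι,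
      HasSum (Set.indicator {l : ι →₀ ℕ | l.support ⊆ S} fun l => l.prod fun k n => y k ^ n)
        (∏ k ∈ S, (1 - y k)⁻¹) := fun y hy S =>
    hasSum_subtype_iff_indicator.1 (hasSum_finsupp_prod_pow_subset hy S)
  have nrm : ∀ l : ι →₀ ℕ, ‖l.prod fun k n => x k ^ n‖ = l.prod fun k n => |x k| ^ n := fun l => by
    simp [Finsupp.prod]
  have hax : ∀ k, |(|x k|)| < 1 := fun k => by simpa using hx k
  have hma := (hasProd_one_sub_inv hax hs.abs).multipliable
  -- Finitely many exponent vectors involve finitely many variables, so a partial sum is at most a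
  -- finite product; all factors are at least 1, so the infinite product bounds it.
  have habs : Summable fun l : ι →₀ ℕ => l.prod fun k n => |x k| ^ n := by
    refine summable_of_sum_le (c := ∏' k, (1 - |x k|)⁻¹)
      (fun l => prod_nonneg fun _ _ => by positivity) fun T => ?_
    set S := T.biUnion fun l => l.support
    have hnn : ∀ l : ι →₀ ℕ, 0 ≤ l.prod fun k n => |x k| ^ n :=
      fun l => prod_nonneg fun _ _ => by positivity
    calc ∑ l ∈ T, l.prod (fun k n => |x k| ^ n)
        = ∑ l ∈ T, Set.indicator {l : ι →₀ ℕ | l.support ⊆ S}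
            (fun l => l.prod fun k n => |x k| ^ n) l := by
          refine sum_congr rfl fun l hl => (Set.indicator_of_mem (Set.mem_ofPred.2 ?_)
            fun l : ι →₀ ℕ => l.prod fun k n => |x k| ^ n).symm
          exact subset_biUnion_of_mem (fun l : ι →₀ ℕ => l.support) hl
      _ ≤ ∏ k ∈ S, (1 - |x k|)⁻¹ :=
          sum_le_hasSum _ (fun l _ => Set.indicator_nonneg (fun l _ => hnn l) l) (ind _ hax S)
      _ ≤ _ := by
          refine ge_of_tendsto hma.hasProd (eventually_ge_atTop S |>.mono fun U hU => ?_)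
          have h1 : ∀ k, 0 < 1 - |x k| := fun k => sub_pos.2 (hx k)
          rw [← prod_sdiff hU]
          refine le_mul_of_one_le_left (prod_nonneg fun k _ => (inv_pos.2 (h1 k)).le) ?_
          exact one_le_prod fun k _ => (one_le_inv₀ (h1 k)).2 (by linarith [abs_nonneg (x k)])
  have hsx : Summable fun l : ι →₀ ℕ => l.prod fun k n => x k ^ n :=
    Summable.of_norm (by simpa only [nrm] using habs)
  -- Dominated convergence as the set of allowed variables exhausts `ι`.
  have hlim : Tendsto (fun S : Finset ι => ∑' l, Set.indicator {l : ι →₀ ℕ | l.support ⊆ S}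
      (fun l => l.prod fun k n => x k ^ n) l) atTop (𝓝 (∑' l : ι →₀ ℕ, l.prod fun k n => x k ^ n)) := by
    refine tendsto_tsum_of_dominated_convergence habs (fun l => ?_) (.of_forall fun S l => ?_)
    · refine tendsto_const_nhds.congr' (eventually_ge_atTop l.support |>.mono fun S hS => ?_)
      exact (Set.indicator_of_mem (show l ∈ {l : ι →₀ ℕ | l.support ⊆ S} from hS)
        fun l : ι →₀ ℕ => l.prod fun k n => x k ^ n).symm
    · exact (norm_indicator_le_norm_self _ _).trans_eq (nrm l)
  simp only [(ind x hx _).tsum_eq] at hlim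
  rw [tendsto_nhds_unique (hasProd_one_sub_inv hx hs) hlim]
  exact hsx.hasSum

/-! ### Operators and states in the occupation-number basis -/

namespace TorusModel

/-- Finiteness is required at every label, not only at `s`: a family that is not summable as
functions would have `tsum` equal to zero. -/
lemma tsum_formalState_apply {ι : Type*} (f : ι → FormalState) (s : Label) (S : Finset ι)
    (hfin : ∀ s, (Function.support fun i => f i s).Finite) (hS : ∀ i ∉ S, f i s = 0) :
    (∑' i, f i) s = ∑ i ∈ S, f i s := by
  rw [tsum_apply (Pi.summable.2 fun s => summable_of_hasFiniteSupport (hfin s)), tsum_eq_sum hS]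

lemma leftCreate_leftAnnihilate (k : ℕ+) (ψ : FormalState) (s : Label) :
    leftCreate k (leftAnnihilate k ψ) s = ((k : ℂ) * s.left k) * ψ s := by
  rcases Nat.eq_zero_or_pos (s.left k) with h | h
  · simp [leftCreate, h]
  · have hsub : s.left - Finsupp.single k 1 + Finsupp.single k 1 = s.left :=
      tsub_add_cancel_of_le (by simpa [Finsupp.single_le_iff, Nat.one_le_iff_ne_zero, pos_iff_ne_zero] using h)
    have hc : ((s.left k - 1 : ℕ) : ℝ) + 1 = s.left k := by
      exact_mod_cast Nat.sub_add_cancel h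
    simp only [leftCreate, leftAnnihilate, hsub, Finsupp.coe_tsub, Pi.sub_apply,
      Finsupp.single_eq_same, hc]
    rw [← mul_assoc, ← Complex.ofReal_mul, Real.mul_self_sqrt (by positivity)]
    push_cast
    rfl

lemma rightCreate_rightAnnihilate (k : ℕ+) (ψ : FormalState) (s : Label) :
    rightCreate k (rightAnnihilate k ψ) s = ((k : ℂ) * s.right k) * ψ s := by
  rcases Nat.eq_zero_or_pos (s.right k) with h | h
  · simp [rightCreate, h]
  · have hsub : s.right - Finsupp.single k 1 + Finsupp.single k 1 = s.right :=
      tsub_add_cancel_of_le (by simpa [Finsupp.single_le_iff, Nat.one_le_iff_ne_zero, pos_iff_ne_zero] using h)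
    have hc : ((s.right k - 1 : ℕ) : ℝ) + 1 = s.right k := by
      exact_mod_cast Nat.sub_add_cancel h
    simp only [rightCreate, rightAnnihilate, hsub, Finsupp.coe_tsub, Pi.sub_apply,
      Finsupp.single_eq_same, hc]
    rw [← mul_assoc, ← Complex.ofReal_mul, Real.mul_self_sqrt (by positivity)]
    push_cast
    rfl

/-- The eigenvalue of the number operator `∑ₖ a₋ₖ aₖ`. -/
def level (l : ℕ+ →₀ ℕ) : ℝ := l.sum fun k n => (k : ℝ) * n

/-- The eigenvalue of the Hamiltonian on an occupation-number basis vector. -/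
noncomputable def energy (R β : ℝ) (s : Label) : ℝ :=
  2 * Real.pi / β *
    ((R * s.wind) ^ 2 + (s.mom / (2 * R)) ^ 2 + level s.left + level s.right - 1 / 12)

lemma tsum_leftCreate_leftAnnihilate (ψ : FormalState) (s : Label) :
    (∑' k : ℕ+, leftCreate k (leftAnnihilate k ψ)) s = (level s.left : ℂ) * ψ s := by
  rw [tsum_formalState_apply _ s s.left.support]
  · simp [leftCreate_leftAnnihilate, level, Finsupp.sum, sum_mul]
  · intro s
    refine s.left.hasFiniteSupport.subset fun k hk => ?_
    simp only [Function.mem_support, leftCreate_leftAnnihilate] at hk ⊢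
    exact fun h => hk (by simp [h])
  · intro k hk
    simp [leftCreate_leftAnnihilate, Finsupp.notMem_support_iff.1 hk]

lemma tsum_rightCreate_rightAnnihilate (ψ : FormalState) (s : Label) :
    (∑' k : ℕ+, rightCreate k (rightAnnihilate k ψ)) s = (level s.right : ℂ) * ψ s := by
  rw [tsum_formalState_apply _ s s.right.support]
  · simp [rightCreate_rightAnnihilate, level, Finsupp.sum, sum_mul]
  · intro s
    refine s.right.hasFiniteSupport.subset fun k hk => ?_
    simp only [Function.mem_support, rightCreate_rightAnnihilate] at hk ⊢
    exact fun h => hk (by simp [h])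
  · intro k hk
    simp [rightCreate_rightAnnihilate, Finsupp.notMem_support_iff.1 hk]

lemma hamiltonian_apply (R β : ℝ) (ψ : FormalState) (s : Label) :
    hamiltonian R β ψ s = (energy R β s : ℂ) * ψ s := by
  simp only [hamiltonian, Pi.smul_apply, Pi.add_apply, Pi.sub_apply, smul_eq_mul,
    tsum_leftCreate_leftAnnihilate, tsum_rightCreate_rightAnnihilate, radiusWinding, halfMomentum,
    energy]
  push_cast
  ring

lemma propagator_apply (R β : ℝ) (ψ : FormalState) (s : Label) :
    propagator R β ψ s = (Real.exp (-energy R β s / 2) : ℂ) * ψ s := by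
  have hit : ∀ (j : ℕ) (s : Label),
      ((fun ψ => (-(1 / 2) : ℂ) • hamiltonian R β ψ)^[j]) ψ s =
        (-(energy R β s : ℂ) / 2) ^ j * ψ s := by
    intro j
    induction j with
    | zero => simp
    | succ j ih =>
      intro s
      rw [Function.iterate_succ_apply', Pi.smul_apply, hamiltonian_apply, ih, pow_succ, smul_eq_mul]
      ring
  have hs : ∀ s, HasSum (fun j : ℕ => (((Nat.factorial j : ℂ)⁻¹) •
      ((fun ψ => (-(1 / 2) : ℂ) • hamiltonian R β ψ)^[j]) ψ) s)
      ((Real.exp (-energy R β s / 2) : ℂ) * ψ s) := fun s => by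
    have h := (NormedSpace.expSeries_div_hasSum_exp (-(energy R β s : ℂ) / 2)).mul_right (ψ s)
    rw [← Complex.exp_eq_exp_ℂ] at h
    simp only [Pi.smul_apply, hit, smul_eq_mul]
    push_cast
    refine h.congr_fun fun j => ?_
    ring
  exact congrFun (HasSum.tsum_eq (Pi.hasSum.2 hs)) s

/-- The two factors $\sqrt k$ from the left and right creation operators cancel $1/k$. -/
lemma pairCreate_apply (ψ : FormalState) (s : Label) :
    pairCreate ψ s = ∑ k ∈ s.left.support, (√((s.left k : ℝ) * s.right k) : ℂ) *
      ψ ⟨s.mom, s.wind, s.left - Finsupp.single k 1, s.right - Finsupp.single k 1⟩ := by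
  have e : ∀ (k : ℕ+) (s : Label), (((k : ℂ)⁻¹) • leftCreate k (rightCreate k ψ)) s =
      (√((s.left k : ℝ) * s.right k) : ℂ) *
      ψ ⟨s.mom, s.wind, s.left - Finsupp.single k 1, s.right - Finsupp.single k 1⟩ := by
    intro k s
    have hk : (0 : ℝ) < k := by exact_mod_cast k.pos
    have hr : √((k : ℝ) * s.left k) * √((k : ℝ) * s.right k) =
        k * √((s.left k : ℝ) * s.right k) := by
      rw [← Real.sqrt_mul (by positivity), show (k : ℝ) * s.left k * (k * s.right k) =
        (k * k) * (s.left k * s.right k) by ring, Real.sqrt_mul (by positivity),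
        Real.sqrt_mul_self hk.le]
    have hk' : (k : ℂ) ≠ 0 := by exact_mod_cast k.ne_zero
    simp only [Pi.smul_apply, smul_eq_mul, leftCreate, rightCreate]
    rw [← mul_assoc (Complex.ofReal _), ← Complex.ofReal_mul, hr, Complex.ofReal_mul,
      Complex.ofReal_natCast, mul_assoc, inv_mul_cancel_left₀ hk']
  rw [pairCreate, tsum_formalState_apply _ s s.left.support]
  · simp only [e]
  · intro s
    refine s.left.hasFiniteSupport.subset fun k hk => ?_
    simp only [Function.mem_support, e] at hk ⊢
    exact fun h => hk (by simp [h])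
  · intro k hk
    simp [e, Finsupp.notMem_support_iff.1 hk]

/-- On the diagonal the square root is $l_k$, and $\sum_k l_k=j+1$ supplies the next factor of the
factorial. -/
lemma iterate_smul_pairCreate_ket (ε : ℂ) (m w : ℤ) (j : ℕ) (s : Label) :
    ((fun ψ => ε • pairCreate ψ)^[j]) (ket m w) s =
      if (s.mom = m ∧ s.wind = w ∧ s.left = s.right) ∧ s.left.degree = j
        then ε ^ j * (j.factorial : ℂ) else 0 := by
  classical
  induction j generalizing s with
  | zero =>
    rw [Function.iterate_zero, id, ket, Pi.single_apply]
    refine if_congr ?_ (by simp) rfl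
    rw [Finsupp.degree_eq_zero_iff, Label.ext_iff]
    constructor
    · rintro ⟨h1, h2, h3, h4⟩
      exact ⟨⟨h1, h2, h3.trans h4.symm⟩, h3⟩
    · rintro ⟨⟨h1, h2, h3⟩, h4⟩
      exact ⟨h1, h2, h4, h3.symm.trans h4⟩
  | succ j ih =>
    rw [Function.iterate_succ_apply', Pi.smul_apply, pairCreate_apply, smul_eq_mul]
    simp only [ih]
    by_cases h : s.mom = m ∧ s.wind = w ∧ s.left = s.right
    · have hd : ∀ k ∈ s.left.support,
          (s.left - Finsupp.single k 1).degree + 1 = s.left.degree := by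
        intro k hk
        have hsub : s.left - Finsupp.single k 1 + Finsupp.single k 1 = s.left :=
          tsub_add_cancel_of_le (by
            simpa [Finsupp.single_le_iff, Nat.one_le_iff_ne_zero] using hk)
        conv_rhs => rw [← hsub]
        simp
      have hsum : ∑ k ∈ s.left.support, (s.left k : ℂ) = (s.left.degree : ℂ) := by
        rw [Finsupp.degree_apply, Nat.cast_sum]
      have ht : ∀ k ∈ s.left.support, ((√((s.left k : ℝ) * s.right k) : ℝ) : ℂ) *
          (if (s.mom = m ∧ s.wind = w ∧
              s.left - Finsupp.single k 1 = s.right - Finsupp.single k 1) ∧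
            (s.left - Finsupp.single k 1).degree = j then ε ^ j * (j.factorial : ℂ) else 0) =
          (s.left k : ℂ) * if s.left.degree = j + 1 then ε ^ j * (j.factorial : ℂ) else 0 := by
        intro k hk
        rw [← h.2.2, Real.sqrt_mul_self (by positivity), Complex.ofReal_natCast, ← hd k hk]
        simp [h.1, h.2.1]
      rw [sum_congr rfl ht, ← sum_mul, hsum]
      by_cases hj : s.left.degree = j + 1
      · rw [if_pos hj, if_pos ⟨h, hj⟩, hj, Nat.factorial_succ]
        push_cast
        ring
      · rw [if_neg hj, if_neg (fun h' => hj h'.2), mul_zero, mul_zero]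
    · rw [if_neg (fun h' => h h'.1), sum_eq_zero, mul_zero]
      intro k hk
      -- With no right quantum to remove, truncated subtraction could create a spurious diagonal
      -- label; the vanishing square root kills that term.
      by_cases hr : s.right k = 0
      · simp [hr]
      · rw [if_neg, mul_zero]
        rintro ⟨⟨h1, h2, h3⟩, -⟩
        refine h ⟨h1, h2, ?_⟩
        have hl : Finsupp.single k 1 ≤ s.left := by
          simpa [Finsupp.single_le_iff, Nat.one_le_iff_ne_zero] using hk
        have hr : Finsupp.single k 1 ≤ s.right := by
          simpa [Finsupp.single_le_iff, Nat.one_le_iff_ne_zero] using hr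
        rw [← tsub_add_cancel_of_le hl, h3, tsub_add_cancel_of_le hr]

lemma expOp_smul_pairCreate_ket (ε : ℂ) (m w : ℤ) (s : Label) :
    expOp (fun ψ => ε • pairCreate ψ) (ket m w) s =
      if s.mom = m ∧ s.wind = w ∧ s.left = s.right then ε ^ s.left.degree else 0 := by
  have hz : ∀ (s : Label) (j : ℕ), j ≠ s.left.degree → (((Nat.factorial j : ℂ)⁻¹) •
      ((fun ψ => ε • pairCreate ψ)^[j]) (ket m w)) s = 0 := fun s j hj => by
    rw [Pi.smul_apply, iterate_smul_pairCreate_ket, if_neg (fun h => hj h.2.symm), smul_zero]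
  rw [expOp, tsum_formalState_apply _ s {s.left.degree}]
  · rw [sum_singleton, Pi.smul_apply, iterate_smul_pairCreate_ket, smul_eq_mul]
    have := Nat.factorial_ne_zero s.left.degree
    by_cases h : s.mom = m ∧ s.wind = w ∧ s.left = s.right
    · rw [if_pos ⟨h, rfl⟩, if_pos h]
      field_simp
    · rw [if_neg (fun h' => h h'.1), if_neg h, mul_zero]
  · intro s
    refine (Set.finite_singleton s.left.degree).subset fun j hj => ?_
    by_contra h
    exact hj (hz s j h)
  · intro j hj
    exact hz s j (by simpa using hj)

lemma neumannState_apply (n : ℤ) (s : Label) : neumannState n s =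
    if s.mom = 0 ∧ s.wind = n ∧ s.left = s.right then (-1) ^ s.left.degree else 0 := by
  rw [← expOp_smul_pairCreate_ket]
  simp [neumannState]

lemma dirichletState_apply (m : ℤ) (s : Label) : dirichletState m s =
    if s.mom = m ∧ s.wind = 0 ∧ s.left = s.right then 1 else 0 := by
  simpa [dirichletState] using expOp_smul_pairCreate_ket 1 m 0 s

end TorusModel

/-! ### Matrix elements and the eta function -/

namespace TorusModel

/-- `exp(ε ∑ₖ a₋ₖ ã₋ₖ / k) |m/R, w⟩` in the occupation-number basis. -/
noncomputable def ishibashi (ε : ℝ) (m w : ℤ) : FormalState := fun s =>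
  if s.mom = m ∧ s.wind = w ∧ s.left = s.right then ((ε ^ s.left.degree : ℝ) : ℂ) else 0

lemma neumannState_eq_ishibashi (n : ℤ) : neumannState n = ishibashi (-1) 0 n := by
  ext s
  simp [neumannState_apply, ishibashi]

lemma dirichletState_eq_ishibashi (m : ℤ) : dirichletState m = ishibashi 1 m 0 := by
  ext s
  simp [dirichletState_apply, ishibashi]

/-- The power of `q` contributed by the zero modes and the Casimir energy. -/
noncomputable def zeroModeWeight (R : ℝ) (m w : ℤ) : ℝ :=
  ((R * w) ^ 2 + (m / (2 * R)) ^ 2) / 2 - 1 / 24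

lemma exp_neg_energy_div_two (R β : ℝ) (m w : ℤ) (l : ℕ+ →₀ ℕ) {q : ℝ}
    (hq : q = Real.exp (-(2 * Real.pi / β))) :
    Real.exp (-energy R β ⟨m, w, l, l⟩ / 2) =
      q ^ zeroModeWeight R m w * l.prod fun k n => (q ^ (k : ℕ)) ^ n := by
  have h : (l.prod fun k n => (q ^ (k : ℕ)) ^ n) = Real.exp (-(2 * Real.pi / β) * level l) := by
    rw [level, Finsupp.sum, mul_sum, Real.exp_sum, Finsupp.prod]
    refine prod_congr rfl fun k _ => ?_
    rw [hq, ← pow_mul, ← Real.exp_nat_mul]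
    congr 1
    push_cast
    ring
  rw [h, hq, ← Real.exp_mul, ← Real.exp_add]
  congr 1
  simp only [energy, zeroModeWeight]
  ring

lemma hasMatrixElement_ishibashi_self (R β : ℝ) {q : ℝ}
    (hq : q = Real.exp (-(2 * Real.pi / β))) (h1 : q < 1) {ε δ : ℝ} (hε : |ε * δ| = 1) (m w : ℤ) :
    HasMatrixElement (ishibashi ε m w) (propagator R β) (ishibashi δ m w)
      ((q ^ zeroModeWeight R m w * (∏' k : ℕ+, (1 - ε * δ * q ^ (k : ℕ)))⁻¹ : ℝ) : ℂ) := by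
  have h0 : 0 < q := hq ▸ Real.exp_pos _
  have hx : ∀ k : ℕ+, |ε * δ * q ^ (k : ℕ)| < 1 := fun k => by
    rw [abs_mul, hε, one_mul, abs_of_pos (by positivity)]
    exact pow_lt_one₀ h0.le h1 k.ne_zero
  have hs : Summable fun k : ℕ+ => ε * δ * q ^ (k : ℕ) :=
    ((summable_geometric_of_lt_one h0.le h1).comp_injective PNat.coe_injective).mul_left _
  have hinj : Function.Injective fun l : ℕ+ →₀ ℕ => (⟨m, w, l, l⟩ : Label) :=
    fun l l' h => congrArg Label.left h
  unfold HasMatrixElement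
  -- Only labels with equal left and right occupation contribute, so the sum is reindexed by one
  -- occupation vector.
  rw [← hinj.hasSum_iff]
  · refine (Complex.hasSum_ofReal.2 ((hasSum_finsupp_prod_pow hx hs).mul_left _)).congr_fun
      fun l => ?_
    have hd : (l.prod fun k n => (ε * δ * q ^ (k : ℕ)) ^ n) =
        ε ^ l.degree * δ ^ l.degree * l.prod fun k n => (q ^ (k : ℕ)) ^ n := by
      simp only [Finsupp.prod, mul_pow, prod_mul_distrib, Finsupp.degree_apply,
        ← prod_pow_eq_pow_sum]
    simp only [Function.comp_apply, propagator_apply, exp_neg_energy_div_two R β m w l hq,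
      ishibashi, and_self, if_true, Complex.conj_ofReal, hd]
    push_cast
    ring
  · rintro ⟨m', w', l, r⟩ hs
    have : ishibashi ε m w ⟨m', w', l, r⟩ = 0 := by
      refine if_neg ?_
      rintro ⟨rfl, rfl, h⟩
      exact hs ⟨l, by simp_all⟩
    simp [this]

lemma hasMatrixElement_ishibashi_of_ne (R β ε δ : ℝ) {m w m' w' : ℤ} (h : ¬(m = m' ∧ w = w')) :
    HasMatrixElement (ishibashi ε m w) (propagator R β) (ishibashi δ m' w') 0 := by
  refine hasSum_zero.congr_fun fun s => ?_
  by_cases hs : s.mom = m ∧ s.wind = w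
  · have : ishibashi δ m' w' s = 0 :=
      if_neg fun h' => h ⟨hs.1.symm.trans h'.1, hs.2.symm.trans h'.2.1⟩
    simp [propagator_apply, this]
  · have : ishibashi ε m w s = 0 := if_neg fun h' => hs ⟨h'.1, h'.2.1⟩
    simp [this]

/-- For positive `q` the complex logarithm is the real one, so the 24th root in `ModularForm.eta` is
the positive real root. -/
lemma etaNome_eq {q : ℝ} (h0 : 0 < q) (h1 : q < 1) :
    etaNome q = ((q ^ (1 / 24 : ℝ) * ∏' k : ℕ+, (1 - q ^ (k : ℕ)) : ℝ) : ℂ) := by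
  have hp : (2 * Real.pi * Complex.I : ℂ) ≠ 0 := Complex.two_pi_I_ne_zero
  have hm : Multipliable fun k : ℕ+ => 1 - q ^ (k : ℕ) := multipliable_one_sub
    ((summable_geometric_of_lt_one h0.le h1).comp_injective PNat.coe_injective)
  have hc : HasProd (fun k : ℕ+ => 1 - (q : ℂ) ^ (k : ℕ))
      ((∏' k : ℕ+, (1 - q ^ (k : ℕ)) : ℝ) : ℂ) := by
    simpa [Function.comp_def] using hm.hasProd.map Complex.ofRealHom Complex.continuous_ofReal
  rw [etaNome, ModularForm.eta]
  simp only [ModularForm.eta_q_eq_pow, mul_div_cancel₀ _ hp,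
    Complex.exp_log (Complex.ofReal_ne_zero.2 h0.ne')]
  rw [← tprod_pnat_eq_tprod_succ (f := fun n => 1 - (q : ℂ) ^ n), hc.tprod_eq, Complex.ofReal_mul,
    Function.Periodic.qParam, mul_div_cancel₀ _ hp, Real.rpow_def_of_pos h0, Complex.ofReal_exp]
  congr 2
  push_cast [Complex.ofReal_log h0.le]
  ring

end TorusModel

/-! ### Product form of the theta series and the conclusion -/

/-- Gauss's identity `∑ (-1) ^ k q ^ (k ^ 2) = ∏ (1 - q ^ k) / ∏ (1 + q ^ k)`. -/
theorem tsum_neg_one_zpow_mul_zpow_sq {q : ℝ} (h0 : 0 < q) (h1 : q < 1) :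
    ∑' k : ℤ, (-1 : ℝ) ^ k * q ^ (k ^ 2) =
      (∏' k : ℕ+, (1 - q ^ (k : ℕ))) * (∏' k : ℕ+, (1 + q ^ (k : ℕ)))⁻¹ := by
  have hs : Summable fun k : ℕ+ => q ^ (k : ℕ) :=
    (summable_geometric_of_lt_one h0.le h1).comp_injective PNat.coe_injective
  have hx : ∀ k : ℕ+, |-q ^ (k : ℕ)| < 1 := fun k => by
    rw [abs_neg, abs_of_pos (by positivity)]
    exact pow_lt_one₀ h0.le h1 k.ne_zero
  have h := (multipliable_one_sub hs).hasProd.mul (hasProd_one_sub_inv hx hs.neg)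
  simp only [sub_neg_eq_add] at h
  have h2 := (hasProd_pnat_iff_hasProd_succ (f := fun n => (1 - q ^ n) * (1 + q ^ n)⁻¹)).1 h
  refine tendsto_nhds_unique (tendsto_thetaPartialProd h0 h1) ?_
  exact h2.tendsto_prod_nat

open TorusModel
theorem lemma1 (R β : ℝ) (hR : 0 < R) (hβ : 0 < β) (q : ℝ)
    (hq : q = Real.exp (-(2 * Real.pi / β))) :
    (∀ n m : ℤ, TorusModel.HasMatrixElement
      (TorusModel.neumannState n) (TorusModel.propagator R β) (TorusModel.neumannState m)
      (if n = m then ((q ^ (R ^ 2 * (n : ℝ) ^ 2 / 2) : ℝ) : ℂ) / TorusModel.etaNome q else 0)) ∧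
    (∀ n m : ℤ, TorusModel.HasMatrixElement
      (TorusModel.dirichletState n) (TorusModel.propagator R β) (TorusModel.dirichletState m)
      (if n = m then ((q ^ ((n : ℝ) ^ 2 / (8 * R ^ 2)) : ℝ) : ℂ) / TorusModel.etaNome q else 0)) ∧
    (∀ n m : ℤ, TorusModel.HasMatrixElement
      (TorusModel.neumannState n) (TorusModel.propagator R β) (TorusModel.dirichletState m)
      (if n = 0 ∧ m = 0 then
        ((q ^ (-(1 / 24) : ℝ) * ∏' k : ℕ+, 1 / (1 + q ^ (k : ℕ)) : ℝ) : ℂ) else 0)) ∧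
    Multipliable (fun k : ℕ+ => 1 / (1 + q ^ (k : ℕ))) ∧
    Summable (fun k : ℤ => (-1 : ℝ) ^ k * q ^ (k ^ 2)) ∧
    TorusModel.etaNome q ≠ 0 ∧
    ((q ^ (-(1 / 24) : ℝ) * ∏' k : ℕ+, 1 / (1 + q ^ (k : ℕ)) : ℝ) : ℂ) =
      ((∑' k : ℤ, (-1 : ℝ) ^ k * q ^ (k ^ 2) : ℝ) : ℂ) / TorusModel.etaNome q := by
  have h0 : 0 < q := hq ▸ Real.exp_pos _
  have h1 : q < 1 := by
    rw [hq, Real.exp_lt_one_iff]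
    exact neg_neg_of_pos (by positivity)
  have hs : Summable fun k : ℕ+ => q ^ (k : ℕ) :=
    (summable_geometric_of_lt_one h0.le h1).comp_injective PNat.coe_injective
  have hx : ∀ k : ℕ+, |q ^ (k : ℕ)| < 1 := fun k => by
    rw [abs_of_pos (by positivity)]
    exact pow_lt_one₀ h0.le h1 k.ne_zero
  have hP := tprod_one_sub_ne_zero hx hs
  have hplus : HasProd (fun k : ℕ+ => 1 / (1 + q ^ (k : ℕ))) (∏' k : ℕ+, (1 + q ^ (k : ℕ)))⁻¹ := by
    simpa using hasProd_one_sub_inv (fun k => by simpa using hx k) hs.neg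
  have hq24 : 0 < q ^ (1 / 24 : ℝ) := Real.rpow_pos_of_pos h0 _
  -- The Casimir shift $-1/24$ becomes the prefactor $q^{1/24}$ of eta in the denominator.
  have hsplit : ∀ c : ℝ, q ^ (c - 1 / 24) * (∏' k : ℕ+, (1 - q ^ (k : ℕ)))⁻¹ =
      q ^ c / (q ^ (1 / 24 : ℝ) * ∏' k : ℕ+, (1 - q ^ (k : ℕ))) := fun c => by
    rw [Real.rpow_sub h0]
    field_simp
  refine ⟨fun n m => ?_, fun n m => ?_, fun n m => ?_, hplus.multipliable,
    summable_neg_one_zpow_mul_zpow_sq h0 h1, ?_, ?_⟩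
  · rw [neumannState_eq_ishibashi, neumannState_eq_ishibashi]
    split_ifs with h
    · subst h
      convert hasMatrixElement_ishibashi_self R β hq h1 (ε := -1) (δ := -1) (by simp) 0 n using 1
      rw [etaNome_eq h0 h1, ← Complex.ofReal_div, ← hsplit]
      simp [zeroModeWeight, mul_pow]
    · exact hasMatrixElement_ishibashi_of_ne R β _ _ fun h' => h h'.2
  · rw [dirichletState_eq_ishibashi, dirichletState_eq_ishibashi]
    split_ifs with h
    · subst h
      convert hasMatrixElement_ishibashi_self R β hq h1 (ε := 1) (δ := 1) (by simp) n 0 using 1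
      rw [etaNome_eq h0 h1, ← Complex.ofReal_div, ← hsplit]
      have : ((n : ℝ) / (2 * R)) ^ 2 / 2 = (n : ℝ) ^ 2 / (8 * R ^ 2) := by
        field_simp
        norm_num
      simp [zeroModeWeight, this]
    · exact hasMatrixElement_ishibashi_of_ne R β _ _ fun h' => h h'.1
  · rw [neumannState_eq_ishibashi, dirichletState_eq_ishibashi]
    split_ifs with h
    · obtain ⟨rfl, rfl⟩ := h
      convert hasMatrixElement_ishibashi_self R β hq h1 (ε := -1) (δ := 1) (by simp) 0 0 using 1
      rw [hplus.tprod_eq]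
      simp [zeroModeWeight]
    · exact hasMatrixElement_ishibashi_of_ne R β _ _ fun h' => h ⟨h'.2, h'.1.symm⟩
  · rw [etaNome_eq h0 h1]
    exact Complex.ofReal_ne_zero.2 (mul_ne_zero hq24.ne' hP)
  · rw [etaNome_eq h0 h1, tsum_neg_one_zpow_mul_zpow_sq h0 h1, hplus.tprod_eq,
      ← Complex.ofReal_div, Real.rpow_neg h0.le]
    congr 1
    field_simp
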